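/- Let $X$ be a (Hausdorff, second countable) complex manifold and let $\Omega\subsetneq X$ be a non-empty connected open set which is complete Kobayashi hyperbolic, i.e. its Kobayashi pseudodistance $k_\Omega$ is a distance and $(\Omega,k_\Omega)$ is a complete metric space. The metric compactification $\overline{\Omega}^{k}$ is the closure of $i_k(\Omega)$ in $C(\Omega,\mathbb R)/\{\text{constants}\}$, where $C(\Omega,\mathbb R)$ is the space of continuous real functions on the metric space $(\Omega,k_\Omega)$ with the topology of locally uniform convergence, the quotient carries the quotient topology, and $i_k(x)=[k_\Omega(x,\cdot)]$. Fix an exhaustion $(K_j)_{j\ge 0}$ of the closure $\overline\Omega$ of $\Omega$ in $X$ by compact sets with $K_j$ contained in the interior of $K_{j+1}$ relative to $\overline\Omega$. An end of $\overline\Omega$ is a decreasing sequence $(F_j)_{j\ge0}$ such that $F_j$ is a connected component of $\overline\Omega\setminus K_j$. The end compactification $\overline\Omega^{\mathrm{End}}$ is the disjoint union of $\overline\Omega$ and the set of ends of $\overline\Omega$; a set $U\subseteq\overline\Omega^{\mathrm{End}}$ is open if $U\cap\overline\Omega$ is open in $\overline\Omega$ and if, for each end $e=(F_j)\in U$, there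 is a $j$ such that $U$ contains $F_j$ and all ends $(G_i)$ with $G_i=F_i$ for $i\le j$. Let $i_\Omega:\Omega\to\overline\Omega^{\mathrm{End}}$ be the inclusion and $\partial\overline\Omega^{\mathrm{End}}:=\overline\Omega^{\mathrm{End}}\setminus i_\Omega(\Omega)$. Suppose that there exists a continuous surjective map $F:\overline\Omega^{k}\to\overline\Omega^{\mathrm{End}}$ such that $F\circ i_k=i_\Omega$ on $\Omega$. Then every geodesic ray $\gamma:[0,\infty)\to\Omega$ (that is, $k_\Omega(\gamma(s),\gamma(t))=|s-t|$ for all $s,t\ge0$) lands: there is exactly one point $x\in\partial\overline\Omega^{\mathrm{End}}$ such that $\gamma(t)\to x$ in $\overline\Omega^{\mathrm{End}}$ as $t\to\infty$. -/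

import Mathlib

open Set Filter Topology Metric
open scoped Manifold ContDiff NNReal

/-! ## The Kobayashi distance of a domain in a complex manifold -/

/-- The Poincaré distance on the unit disc (normalised so that
`ρ(0, r) = artanh r = ½ log ((1 + r) / (1 - r))`). It is only used for `a`, `b` in the disc. -/
noncomputable def poincareDist (a b : ℂ) : ℝ :=
  Real.artanh ‖(a - b) / (1 - (starRingEnd ℂ) a * b)‖

section Kobayashi

variable (n : ℕ) {X : Type*} [TopologicalSpace X] [ChartedSpace (EuclideanSpace ℂ (Fin n)) X]

/-- A holomorphic map from the open unit disc into the subset `Ω` of the `n`-dimensional complex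
manifold `X`. The values of `f` outside the disc are irrelevant. -/
structure IsHolomorphicDisc (Ω : Set X) (f : ℂ → X) : Prop where
  holomorphic : MDifferentiableOn 𝓘(ℂ, ℂ) 𝓘(ℂ, EuclideanSpace ℂ (Fin n)) f (ball (0 : ℂ) 1)
  mapsTo : MapsTo f (ball (0 : ℂ) 1) Ω

/-- `IsDiscChain n Ω x y L`: the points `x` and `y` of `Ω` are joined by a finite chain of
holomorphic discs in `Ω`, the sum of whose Poincaré lengths is `L`. -/
inductive IsDiscChain (Ω : Set X) : X → X → ℝ → Prop
  | nil {x : X} (hx : x ∈ Ω) : IsDiscChain Ω x x 0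
  | cons {f : ℂ → X} {a b : ℂ} {y : X} {L : ℝ} (hf : IsHolomorphicDisc n Ω f)
      (ha : a ∈ ball (0 : ℂ) 1) (hb : b ∈ ball (0 : ℂ) 1) (h : IsDiscChain Ω (f b) y L) :
      IsDiscChain Ω (f a) y (poincareDist a b + L)

/-- The Kobayashi (pseudo)distance of `Ω`: the infimum of the lengths of chains of holomorphic
discs. -/
noncomputable def kobayashiDist (Ω : Set X) (x y : X) : ℝ :=
  sInf {L : ℝ | IsDiscChain n Ω x y L}

/-- `Ω` is a Kobayashi hyperbolic domain in `X`: a (non-empty) connected open set whose Kobayashi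
pseudodistance separates points. -/
structure IsKobayashiHyperbolicDomain (Ω : Set X) : Prop where
  isOpen : IsOpen Ω
  isConnected : IsConnected Ω
  eq_of_kobayashiDist_eq_zero : ∀ x ∈ Ω, ∀ y ∈ Ω, kobayashiDist n Ω x y = 0 → x = y

theorem poincareDist_nonneg (a b : ℂ) : 0 ≤ poincareDist a b :=
  Real.artanh_nonneg (norm_nonneg _)

theorem poincareDist_comm (a b : ℂ) : poincareDist a b = poincareDist b a := by
  unfold poincareDist
  rw [norm_div, norm_div, norm_sub_rev a b]
  congr 2
  rw [← Complex.norm_conj]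
  simp [mul_comm]

variable {n}

theorem IsDiscChain.nonneg {Ω : Set X} {x y : X} {L : ℝ} (h : IsDiscChain n Ω x y L) : 0 ≤ L := by
  induction h with
  | nil hx => exact le_rfl
  | cons hf ha hb h ih => exact add_nonneg (poincareDist_nonneg _ _) ih

theorem IsDiscChain.trans {Ω : Set X} {x y z : X} {L M : ℝ} (h : IsDiscChain n Ω x y L)
    (h' : IsDiscChain n Ω y z M) : IsDiscChain n Ω x z (L + M) := by
  induction h with
  | nil hx => simpa using h'
  | cons hf ha hb h ih => rw [add_assoc]; exact .cons hf ha hb (ih h')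

theorem IsDiscChain.symm {Ω : Set X} {x y : X} {L : ℝ} (h : IsDiscChain n Ω x y L) :
    IsDiscChain n Ω y x L := by
  induction h with
  | nil hx => exact .nil hx
  | cons hf ha hb h ih =>
    have h1 := ih.trans (.cons hf hb ha (.nil (hf.mapsTo ha)))
    rwa [add_zero, poincareDist_comm, add_comm] at h1

theorem IsDiscChain.of_disc {Ω : Set X} {f : ℂ → X} (hf : IsHolomorphicDisc n Ω f) {a b : ℂ}
    (ha : a ∈ ball (0 : ℂ) 1) (hb : b ∈ ball (0 : ℂ) 1) :
    IsDiscChain n Ω (f a) (f b) (poincareDist a b) := by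
  simpa using IsDiscChain.cons hf ha hb (.nil (hf.mapsTo hb))

theorem eventually_exists_isDiscChain
    [IsManifold 𝓘(ℂ, EuclideanSpace ℂ (Fin n)) ω X] {Ω : Set X} (hΩ : IsOpen Ω)
    {x : X} (hx : x ∈ Ω) : ∀ᶠ y in 𝓝 x, ∃ L, IsDiscChain n Ω x y L := by
  set φ := chartAt (EuclideanSpace ℂ (Fin n)) x with hφ
  have hxs : x ∈ φ.source := mem_chart_source _ x
  have hV : IsOpen (φ.target ∩ φ.symm ⁻¹' Ω) := φ.isOpen_inter_preimage_symm hΩ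
  have hxV : φ x ∈ φ.target ∩ φ.symm ⁻¹' Ω :=
    ⟨φ.map_source hxs, by simpa [φ.left_inv hxs] using hx⟩
  obtain ⟨r, hr, hball⟩ := Metric.isOpen_iff.1 hV _ hxV
  filter_upwards [φ.open_source.mem_nhds hxs,
    (φ.continuousAt hxs).preimage_mem_nhds (Metric.ball_mem_nhds _ (half_pos hr))] with y hys hy
  have hy' : ‖φ y - φ x‖ < r / 2 := mem_ball_iff_norm.1 hy
  let g : ℂ → EuclideanSpace ℂ (Fin n) := fun t => φ x + (2 * t) • (φ y - φ x)
  have hg : MapsTo g (ball 0 1) (φ.target ∩ φ.symm ⁻¹' Ω) := by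
    intro t ht
    apply hball
    have ht' : ‖t‖ < 1 := by simpa using ht
    have : ‖(2 * t) • (φ y - φ x)‖ < r := by
      rw [norm_smul, norm_mul, Complex.norm_ofNat]
      nlinarith [norm_nonneg t, norm_nonneg (φ y - φ x)]
    simpa [g, mem_ball_iff_norm] using this
  have hgd : MDifferentiableOn 𝓘(ℂ, ℂ) 𝓘(ℂ, EuclideanSpace ℂ (Fin n)) g (ball 0 1) := by
    have : Differentiable ℂ g := by fun_prop
    exact this.mdifferentiable.mdifferentiableOn
  have : IsManifold 𝓘(ℂ, EuclideanSpace ℂ (Fin n)) 1 X := IsManifold.of_le (n := ω) le_top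
  have hf : IsHolomorphicDisc n Ω (φ.symm ∘ g) :=
    ⟨(mdifferentiableOn_atlas_symm (chart_mem_atlas _ x)).comp hgd fun t ht => (hg ht).1,
      fun t ht => (hg ht).2⟩
  have h := IsDiscChain.of_disc hf (a := 0) (b := 1 / 2) (by simp) (by norm_num)
  have h0 : (φ.symm ∘ g) 0 = x := by simp [g, φ.left_inv hxs]
  have h1 : (φ.symm ∘ g) (1 / 2) = y := by simp [g, φ.left_inv hys]
  rw [h0, h1] at h
  exact ⟨_, h⟩

/-- In a domain, any two points are joined by a chain of holomorphic discs, so that the infimum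
in the definition of `kobayashiDist` is that of a non-empty set of non-negative numbers. -/
theorem exists_isDiscChain [IsManifold 𝓘(ℂ, EuclideanSpace ℂ (Fin n)) ω X] {Ω : Set X}
    (hΩ : IsOpen Ω) (hc : IsPreconnected Ω) {x y : X} (hx : x ∈ Ω) (hy : y ∈ Ω) :
    ∃ L, IsDiscChain n Ω x y L := by
  refine hc.induction₂ (fun x y => ∃ L, IsDiscChain n Ω x y L) (fun z hz => ?_) ?_ ?_ hx hy
  · exact (eventually_exists_isDiscChain hΩ hz).filter_mono nhdsWithin_le_nhds
  · rintro a b c - - - ⟨L, h⟩ ⟨M, h'⟩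
    exact ⟨_, h.trans h'⟩
  · rintro a b - - ⟨L, h⟩
    exact ⟨_, h.symm⟩

theorem bddBelow_isDiscChain (Ω : Set X) (x y : X) :
    BddBelow {L : ℝ | IsDiscChain n Ω x y L} := ⟨0, fun _ h => h.nonneg⟩

theorem kobayashiDist_self {Ω : Set X} {x : X} (hx : x ∈ Ω) : kobayashiDist n Ω x x = 0 :=
  le_antisymm (csInf_le (bddBelow_isDiscChain Ω x x) (.nil hx))
    (Real.sInf_nonneg fun _ h => h.nonneg)

theorem kobayashiDist_comm (Ω : Set X) (x y : X) :
    kobayashiDist n Ω x y = kobayashiDist n Ω y x := by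
  unfold kobayashiDist
  congr 1
  ext L
  exact ⟨fun h => h.symm, fun h => h.symm⟩

theorem kobayashiDist_triangle [IsManifold 𝓘(ℂ, EuclideanSpace ℂ (Fin n)) ω X] {Ω : Set X}
    (hΩ : IsOpen Ω) (hc : IsPreconnected Ω) {x y z : X} (hx : x ∈ Ω) (hy : y ∈ Ω) (hz : z ∈ Ω) :
    kobayashiDist n Ω x z ≤ kobayashiDist n Ω x y + kobayashiDist n Ω y z := by
  refine le_of_forall_pos_le_add fun ε hε => ?_
  obtain ⟨L, hL, hL'⟩ := Real.lt_sInf_add_pos (exists_isDiscChain (n := n) hΩ hc hx hy)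
    (half_pos hε)
  obtain ⟨M, hM, hM'⟩ := Real.lt_sInf_add_pos (exists_isDiscChain (n := n) hΩ hc hy hz)
    (half_pos hε)
  have h := csInf_le (bddBelow_isDiscChain Ω x z) (IsDiscChain.trans hL hM)
  change kobayashiDist n Ω x z ≤ _ at h
  change L < kobayashiDist n Ω x y + _ at hL'
  change M < kobayashiDist n Ω y z + _ at hM'
  linarith

/-- The set `Ω`, regarded as the metric space `(Ω, k_Ω)`. -/
def KobayashiSpace {Ω : Set X} (_ : IsKobayashiHyperbolicDomain n Ω) : Type _ := Ω

noncomputable instance KobayashiSpace.instMetricSpace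
    [IsManifold 𝓘(ℂ, EuclideanSpace ℂ (Fin n)) ω X] {Ω : Set X}
    (h : IsKobayashiHyperbolicDomain n Ω) : MetricSpace (KobayashiSpace h) where
  dist x y := kobayashiDist n Ω x.1 y.1
  dist_self x := kobayashiDist_self x.2
  dist_comm x y := kobayashiDist_comm Ω x.1 y.1
  dist_triangle x y z := kobayashiDist_triangle h.isOpen h.isConnected.isPreconnected x.2 y.2 z.2
  eq_of_dist_eq_zero {x y} hxy :=
    Subtype.ext (h.eq_of_kobayashiDist_eq_zero x.1 x.2 y.1 y.2 hxy)

/-- The inclusion of `(Ω, k_Ω)` into the closure of `Ω` in `X`. -/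
def KobayashiSpace.toClosure {Ω : Set X} {h : IsKobayashiHyperbolicDomain n Ω}
    (x : KobayashiSpace h) : closure Ω :=
  ⟨x.1, subset_closure x.2⟩

end Kobayashi

/-! ## The metric (horofunction) compactification -/

section MetricCompactification

variable (M : Type*) [MetricSpace M]

/-- The subspace of constant functions in `C(M, ℝ)`. -/
def constFunctions : Submodule ℝ C(M, ℝ) where
  carrier := {f | ∃ c : ℝ, f = ContinuousMap.const M c}
  add_mem' := by
    rintro _ _ ⟨a, rfl⟩ ⟨b, rfl⟩
    exact ⟨a + b, rfl⟩
  zero_mem' := ⟨0, rfl⟩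
  smul_mem' := by
    rintro r _ ⟨a, rfl⟩
    exact ⟨r * a, rfl⟩

/-- The space of continuous functions modulo constants, with the quotient of the compact-open
topology (the topology of locally uniform convergence). -/
abbrev FunctionsModConst : Type _ := C(M, ℝ) ⧸ constFunctions M

variable {M}

/-- The canonical map `x ↦ [d(x, ·)]`. -/
noncomputable def metricEmbedding (x : M) : FunctionsModConst M :=
  (constFunctions M).mkQ ⟨fun z => dist x z, by fun_prop⟩

variable (M)

/-- The metric compactification of `M`: the closure of the image of `M` in the space of
continuous functions modulo constants. -/
def metricCompactification : Set (FunctionsModConst M) :=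
  closure (range (metricEmbedding (M := M)))

variable {M}

/-- The canonical map `x ↦ [d(x, ·)]`, with values in the metric compactification. -/
noncomputable def toMetricCompactification (x : M) : metricCompactification M :=
  ⟨metricEmbedding x, subset_closure (mem_range_self x)⟩

end MetricCompactification

/-! ## The end compactification -/

section Ends

variable {Y : Type*} [TopologicalSpace Y]

/-- An end of `Y`, with respect to the compact exhaustion `K`: a decreasing sequence of connected
components of the sets `Y \ K j`. -/
@[ext]
structure SpaceEnd (K : CompactExhaustion Y) where
  comp : ℕ → Set Y
  isComponent : ∀ j, ∃ y ∈ (K j)ᶜ, comp j = connectedComponentIn (K j)ᶜ y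
  decreasing : ∀ j, comp (j + 1) ⊆ comp j

/-- The disjoint union of `Y` and the set of its ends. -/
inductive EndCompactification (K : CompactExhaustion Y) where
  | point (y : Y) : EndCompactification K
  | ideal (e : SpaceEnd K) : EndCompactification K

namespace EndCompactification

variable {K : CompactExhaustion Y}

/-- The basic neighbourhood `F_j ⊔ {f | f_i = F_i for all i ≤ j}` of the end `(F_j)`. -/
def basicNhd (e : SpaceEnd K) (j : ℕ) : Set (EndCompactification K) :=
  point '' e.comp j ∪ ideal '' {f | ∀ i ≤ j, f.comp i = e.comp i}

theorem basicNhd_anti (e : SpaceEnd K) {i j : ℕ} (h : i ≤ j) : basicNhd e j ⊆ basicNhd e i :=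
  union_subset_union (image_mono (antitone_nat_of_succ_le e.decreasing h))
    (image_mono fun _ hf k hk => hf k (hk.trans h))

/-- The topology of the end compactification: a set is open when it contains, with each point of
`Y`, a neighbourhood of it in `Y` and, with each end, one of its basic neighbourhoods. -/
instance instTopologicalSpace : TopologicalSpace (EndCompactification K) where
  IsOpen U := IsOpen (point ⁻¹' U) ∧ ∀ e, ideal e ∈ U → ∃ j, basicNhd e j ⊆ U
  isOpen_univ := ⟨isOpen_univ, fun _ _ => ⟨0, subset_univ _⟩⟩
  isOpen_inter U V hU hV := by
    refine ⟨hU.1.inter hV.1, fun e he => ?_⟩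
    obtain ⟨i, hi⟩ := hU.2 e he.1
    obtain ⟨j, hj⟩ := hV.2 e he.2
    exact ⟨max i j, subset_inter ((basicNhd_anti e (le_max_left i j)).trans hi)
      ((basicNhd_anti e (le_max_right i j)).trans hj)⟩
  isOpen_sUnion S hS := by
    refine ⟨?_, ?_⟩
    · rw [preimage_sUnion]
      exact isOpen_biUnion fun U hU => (hS U hU).1
    · rintro e ⟨U, hU, he⟩
      obtain ⟨j, hj⟩ := (hS U hU).2 e he
      exact ⟨j, hj.trans (subset_sUnion_of_mem hU)⟩

end EndCompactification

end Ends

/-! ### Separation of the end compactification -/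

section Components

variable {Y : Type*} [TopologicalSpace Y]

/-! Along a geodesic ray, `d(γ t, z) - t` decreases in `t` to a Busemann function. By Dini the
convergence is locally uniform, and the shift by `t` vanishes modulo constants, so the ray converges
in the metric compactification (`exists_tendsto_toMetricCompactification`). Applying `F` gives a
limit in the end compactification.

The limit is unique because the end compactification is Hausdorff (`instT2Space`). It is not a point
of `Ω`: since `k_Ω` is continuous for the topology of `X` (`tendsto_kobayashiDist_nhds`), the ray
would then converge in `k_Ω`, which an isometry cannot do (`not_tendsto_ray`). -/

/-- A set between a connected set and its closure is connected, so maximality makes components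
relatively closed. They need not be open, as local connectedness is not assumed; complete normality
then separates them. -/
theorem closure_connectedComponentIn_inter_subset (S : Set Y) (x : Y) :
    closure (connectedComponentIn S x) ∩ S ⊆ connectedComponentIn S x := by
  by_cases hx : x ∈ S
  · refine IsPreconnected.subset_connectedComponentIn ?_
      ⟨subset_closure (mem_connectedComponentIn hx), hx⟩ inter_subset_right
    exact isPreconnected_connectedComponentIn.subset_closure
      (subset_inter subset_closure (connectedComponentIn_subset S x)) inter_subset_left
  · simp [connectedComponentIn_eq_empty hx]

theorem connectedComponentIn_eq_or_disjoint (S : Set Y) (x y : Y) :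
    connectedComponentIn S x = connectedComponentIn S y ∨
      Disjoint (connectedComponentIn S x) (connectedComponentIn S y) := by
  refine or_iff_not_imp_right.2 fun h => ?_
  obtain ⟨z, hzx, hzy⟩ := not_disjoint_iff.1 h
  rw [connectedComponentIn_eq hzx, connectedComponentIn_eq hzy]

/-- Disjoint components of a subset of a completely normal space have disjoint neighbourhoods. -/
theorem separatedNhds_connectedComponentIn [CompletelyNormalSpace Y] {S : Set Y} {x y : Y}
    (h : Disjoint (connectedComponentIn S x) (connectedComponentIn S y)) :
    SeparatedNhds (connectedComponentIn S x) (connectedComponentIn S y) := by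
  refine separatedNhds_iff_disjoint.2 (completely_normal ?_ ?_)
  · exact disjoint_left.2 fun z hz hzy => disjoint_left.1 h
      (closure_connectedComponentIn_inter_subset S x
        ⟨hz, connectedComponentIn_subset S y hzy⟩) hzy
  · exact disjoint_left.2 fun z hzx hz => disjoint_left.1 h hzx
      (closure_connectedComponentIn_inter_subset S y
        ⟨hz, connectedComponentIn_subset S x hzx⟩)

end Components

namespace EndCompactification

variable {Y : Type*} [TopologicalSpace Y] {K : CompactExhaustion Y}

theorem isOpen_iff {U : Set (EndCompactification K)} :
    IsOpen U ↔ IsOpen (point ⁻¹' U) ∧ ∀ e, ideal e ∈ U → ∃ j, basicNhd e j ⊆ U := Iff.rfl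

theorem point_injective : Function.Injective (point : Y → EndCompactification K) :=
  fun _ _ h => by injection h

theorem ideal_injective : Function.Injective (ideal : SpaceEnd K → EndCompactification K) :=
  fun _ _ h => by injection h

/-- The image of an open set of `Y` contains no end, so the condition at ends is vacuous. -/
theorem isOpenEmbedding_point : IsOpenEmbedding (point : Y → EndCompactification K) := by
  refine .of_continuous_injective_isOpenMap
    (continuous_def.2 fun U hU => hU.1) point_injective fun U hU => ⟨?_, ?_⟩
  · rwa [preimage_image_eq U point_injective]
  · rintro e ⟨y, -, h⟩
    cases h

/-- An open set of `Y` containing `F_j`, together with the ends through `F_0, …, F_j`, is open. -/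
theorem isOpen_point_image_union {e : SpaceEnd K} {j : ℕ} {U : Set Y} (hU : IsOpen U)
    (he : e.comp j ⊆ U) :
    IsOpen (point '' U ∪ ideal '' {f : SpaceEnd K | ∀ i ≤ j, f.comp i = e.comp i}) := by
  refine isOpen_iff.2 ⟨?_, ?_⟩
  · have h : (point : Y → EndCompactification K) ⁻¹'
        (ideal '' {f : SpaceEnd K | ∀ i ≤ j, f.comp i = e.comp i}) = ∅ := by
      ext y; simp
    rwa [preimage_union, preimage_image_eq U point_injective, h, union_empty]
  · rintro f (⟨y, -, h⟩ | ⟨g, hg, h⟩)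
    · cases h
    · obtain rfl := ideal_injective h
      -- `f` and `e` agree up to level `j`, so they have the same basic neighbourhood at that level.
      refine ⟨j, union_subset_union (image_mono ?_) (image_mono ?_)⟩
      · rw [hg j le_rfl]; exact he
      · intro k hk i hi
        rw [hk i hi, hg i hi]

theorem _root_.SpaceEnd.comp_subset (e : SpaceEnd K) (j : ℕ) : e.comp j ⊆ (K j)ᶜ := by
  obtain ⟨y, -, h⟩ := e.isComponent j
  rw [h]
  exact connectedComponentIn_subset _ _

/-- Some `K j` is a neighbourhood of `y`, while the end lives in its complement. -/
theorem exists_separation_point_ideal (y : Y) (e : SpaceEnd K) [T2Space Y] :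
    ∃ U V : Set (EndCompactification K), IsOpen U ∧ IsOpen V ∧ point y ∈ U ∧ ideal e ∈ V ∧
      Disjoint U V := by
  obtain ⟨j, hj⟩ := K.exists_mem_nhds y
  refine ⟨point '' interior (K j),
    point '' (K j)ᶜ ∪ ideal '' {f : SpaceEnd K | ∀ i ≤ j, f.comp i = e.comp i},
    isOpenEmbedding_point.isOpenMap _ isOpen_interior,
    isOpen_point_image_union (K.isCompact j).isClosed.isOpen_compl (e.comp_subset j),
    mem_image_of_mem _ (mem_interior_iff_mem_nhds.2 hj), Or.inr ⟨e, fun _ _ => rfl, rfl⟩, ?_⟩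
  rw [disjoint_left]
  rintro _ ⟨a, ha, rfl⟩ (⟨b, hb, h⟩ | ⟨f, -, h⟩)
  · obtain rfl := point_injective h
    exact hb (interior_subset ha)
  · cases h

/-- The end compactification of a completely normal Hausdorff space is Hausdorff. -/
instance instT2Space [T2Space Y] [CompletelyNormalSpace Y] : T2Space (EndCompactification K) := by
  refine ⟨fun a b hab => ?_⟩
  rcases a with y | e <;> rcases b with z | f
  · obtain ⟨U, V, hU, hV, hy, hz, hUV⟩ := t2_separation (ne_of_apply_ne point hab)
    exact ⟨_, _, isOpenEmbedding_point.isOpenMap U hU, isOpenEmbedding_point.isOpenMap V hV,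
      mem_image_of_mem _ hy, mem_image_of_mem _ hz, (disjoint_image_iff point_injective).2 hUV⟩
  · exact exists_separation_point_ideal y f
  · obtain ⟨U, V, hU, hV, hz, he, hUV⟩ := exists_separation_point_ideal z e
    exact ⟨V, U, hV, hU, he, hz, hUV.symm⟩
  · obtain ⟨j, hj⟩ : ∃ j, e.comp j ≠ f.comp j := by
      by_contra! h
      exact hab (congrArg ideal (SpaceEnd.ext (funext h)))
    obtain ⟨U, V, hU, hV, heU, hfV, hUV⟩ : SeparatedNhds (e.comp j) (f.comp j) := by
      obtain ⟨y, -, hy⟩ := e.isComponent j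
      obtain ⟨z, -, hz⟩ := f.isComponent j
      rw [hy, hz] at hj ⊢
      exact separatedNhds_connectedComponentIn
        ((connectedComponentIn_eq_or_disjoint _ _ _).resolve_left hj)
    refine ⟨_, _, isOpen_point_image_union hU heU, isOpen_point_image_union hV hfV,
      Or.inr ⟨e, fun _ _ => rfl, rfl⟩, Or.inr ⟨f, fun _ _ => rfl, rfl⟩, ?_⟩
    rw [disjoint_left]
    rintro _ (⟨a, ha, rfl⟩ | ⟨g, hg, rfl⟩) (⟨b, hb, h⟩ | ⟨k, hk, h⟩)
    · obtain rfl := point_injective h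
      exact disjoint_left.1 hUV ha hb
    · cases h
    · cases h
    · obtain rfl := ideal_injective h
      exact hj ((hg j le_rfl).symm.trans (hk j le_rfl))

end EndCompactification

/-! ### Busemann functions of geodesic rays -/

section Busemann

variable {M : Type*} [MetricSpace M] {γ : ℝ≥0 → M}

/-- Going from `γ t` to `z` through `γ s` costs an extra `t - s`. -/
theorem antitone_dist_ray_sub (hγ : Isometry γ) (z : M) :
    Antitone fun t : ℝ≥0 => dist (γ t) z - t := by
  intro s t hst
  have h := dist_triangle (γ t) (γ s) z
  have hst' : (s : ℝ) ≤ t := hst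
  rw [hγ.dist_eq, NNReal.dist_eq, abs_of_nonneg (sub_nonneg.2 hst')] at h
  change dist (γ t) z - t ≤ dist (γ s) z - s
  linarith

theorem exists_tendsto_dist_ray_sub (hγ : Isometry γ) (z : M) :
    ∃ b : ℝ, Tendsto (fun t : ℝ≥0 => dist (γ t) z - t) atTop (𝓝 b) := by
  refine ⟨_, tendsto_atTop_ciInf (antitone_dist_ray_sub hγ z) ⟨-dist (γ 0) z, ?_⟩⟩
  rintro _ ⟨t, rfl⟩
  have h := dist_triangle_right (γ t) (γ 0) z
  rw [hγ.dist_eq, NNReal.dist_eq, NNReal.coe_zero, sub_zero, abs_of_nonneg t.coe_nonneg] at h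
  change -dist (γ 0) z ≤ dist (γ t) z - t
  linarith

/-- Along a geodesic ray, the images in the metric compactification converge (to the class of the
Busemann function of the ray). -/
theorem exists_tendsto_toMetricCompactification (hγ : Isometry γ) :
    ∃ p : metricCompactification M,
      Tendsto (fun t => toMetricCompactification (γ t)) atTop (𝓝 p) := by
  choose b hb using exists_tendsto_dist_ray_sub hγ
  have hlip : LipschitzWith 1 b := LipschitzWith.of_le_add fun y z => by
    -- The bound `d(γ t, y) - t ≤ d(γ t, z) - t + d(y, z)` passes to the limit; Dini needs the
    -- resulting continuity of `b`.
    refine le_of_tendsto_of_tendsto' (hb y) ((hb z).add_const _) fun t => ?_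
    have := dist_triangle_right (γ t) y z
    have := dist_triangle (γ t) z y
    rw [dist_comm z y] at this
    linarith
  let f : ℝ≥0 → C(M, ℝ) := fun t => ⟨fun z => dist (γ t) z - t, by fun_prop⟩
  have hf : Tendsto f atTop (𝓝 ⟨b, hlip.continuous⟩) :=
    ContinuousMap.tendsto_of_antitone_of_pointwise
      (fun s t hst z => antitone_dist_ray_sub hγ z hst) hb
  have hmk : ∀ t, (constFunctions M).mkQ (f t) = metricEmbedding (γ t) := fun t => by
    refine (Submodule.Quotient.eq _).2 ⟨-t, ?_⟩
    ext z
    change dist (γ t) z - t - dist (γ t) z = -t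
    ring
  have hq : Tendsto (fun t => metricEmbedding (γ t)) atTop
      (𝓝 ((constFunctions M).mkQ ⟨b, hlip.continuous⟩)) := by
    have hc : Continuous (constFunctions M).mkQ := continuous_quot_mk
    exact ((hc.tendsto _).comp hf).congr hmk
  exact ⟨⟨_, mem_closure_of_tendsto hq (Eventually.of_forall fun t => mem_range_self _)⟩,
    tendsto_subtype_rng.2 hq⟩

/-- A geodesic ray does not converge. -/
theorem not_tendsto_ray (hγ : Isometry γ) (p : M) : ¬ Tendsto γ atTop (𝓝 p) := by
  intro h
  obtain ⟨T, hT⟩ := eventually_atTop.1 ((tendsto_iff_dist_tendsto_zero.1 h).eventually_lt_const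
    (show (0 : ℝ) < 1 / 2 by norm_num))
  have h1 := hT T le_rfl
  -- `γ T` and `γ (T + 1)` are at distance 1, yet both lie within less than 1/2 of `p`.
  have h2 := hT (T + 1) le_self_add
  have h3 := dist_triangle_right (γ T) (γ (T + 1)) p
  rw [hγ.dist_eq, NNReal.dist_eq, NNReal.coe_add, NNReal.coe_one, sub_add_cancel_left, abs_neg,
    abs_one] at h3
  linarith

end Busemann

/-! ### Continuity of the Kobayashi distance -/

theorem Real.tendsto_artanh_zero : Tendsto Real.artanh (𝓝 0) (𝓝 0) := by
  have h : ContinuousAt Real.artanh 0 := by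
    unfold Real.artanh
    refine ContinuousAt.log (ContinuousAt.sqrt ?_) (by simp)
    exact ContinuousAt.div (by fun_prop) (by fun_prop) (by simp)
  simpa [ContinuousAt] using h

section Kobayashi

variable {n : ℕ} {X : Type*} [TopologicalSpace X] [ChartedSpace (EuclideanSpace ℂ (Fin n)) X]

/-- Points close to `x` are joined to `x` by a single disc, of arbitrarily small length. -/
theorem eventually_isDiscChain_artanh [IsManifold 𝓘(ℂ, EuclideanSpace ℂ (Fin n)) ω X]
    {Ω : Set X} (hΩ : IsOpen Ω) {x : X} (hx : x ∈ Ω) {s : ℝ} (hs0 : 0 < s) (hs1 : s < 1) :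
    ∀ᶠ y in 𝓝 x, IsDiscChain n Ω x y (Real.artanh s) := by
  set φ := chartAt (EuclideanSpace ℂ (Fin n)) x with hφ
  have hxs : x ∈ φ.source := mem_chart_source _ x
  have hV : IsOpen (φ.target ∩ φ.symm ⁻¹' Ω) := φ.isOpen_inter_preimage_symm hΩ
  have hxV : φ x ∈ φ.target ∩ φ.symm ⁻¹' Ω :=
    ⟨φ.map_source hxs, by simpa [φ.left_inv hxs] using hx⟩
  obtain ⟨r, hr, hball⟩ := Metric.isOpen_iff.1 hV _ hxV
  filter_upwards [φ.open_source.mem_nhds hxs, (φ.continuousAt hxs).preimage_mem_nhds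
    (Metric.ball_mem_nhds _ (mul_pos hs0 hr))] with y hys hy
  have hy' : ‖φ y - φ x‖ < s * r := mem_ball_iff_norm.1 hy
  have hsC : (s : ℂ) ≠ 0 := by exact_mod_cast hs0.ne'
  -- An affine disc with `0 ↦ φ x` and `s ↦ φ y`; as `‖φ y - φ x‖ < s * r`, it stays in the ball of
  -- radius `r`.
  let g : ℂ → EuclideanSpace ℂ (Fin n) := fun t => φ x + (t / s) • (φ y - φ x)
  have hg : MapsTo g (ball 0 1) (φ.target ∩ φ.symm ⁻¹' Ω) := by
    intro t ht
    apply hball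
    have ht' : ‖t‖ < 1 := by simpa using ht
    have : ‖(t / s) • (φ y - φ x)‖ < r := by
      rw [norm_smul, norm_div, Complex.norm_real, Real.norm_of_nonneg hs0.le, div_mul_eq_mul_div,
        div_lt_iff₀ hs0, mul_comm r]
      exact (mul_le_of_le_one_left (norm_nonneg _) ht'.le).trans_lt hy'
    simpa [g, mem_ball_iff_norm] using this
  have hgd : MDifferentiableOn 𝓘(ℂ, ℂ) 𝓘(ℂ, EuclideanSpace ℂ (Fin n)) g (ball 0 1) := by
    have : Differentiable ℂ g := by fun_prop
    exact this.mdifferentiable.mdifferentiableOn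
  have : IsManifold 𝓘(ℂ, EuclideanSpace ℂ (Fin n)) 1 X := IsManifold.of_le (n := ω) le_top
  have hf : IsHolomorphicDisc n Ω (φ.symm ∘ g) :=
    ⟨(mdifferentiableOn_atlas_symm (chart_mem_atlas _ x)).comp hgd fun t ht => (hg ht).1,
      fun t ht => (hg ht).2⟩
  have h := IsDiscChain.of_disc hf (a := 0) (b := s) (by simp)
    (by simpa [abs_of_pos hs0] using hs1)
  have h0 : (φ.symm ∘ g) 0 = x := by simp [g, φ.left_inv hxs]
  have h1 : (φ.symm ∘ g) s = y := by simp [g, φ.left_inv hys, div_self hsC]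
  have h2 : poincareDist 0 s = Real.artanh s := by simp [poincareDist, abs_of_pos hs0]
  rwa [h0, h1, h2] at h

theorem tendsto_kobayashiDist_nhds [IsManifold 𝓘(ℂ, EuclideanSpace ℂ (Fin n)) ω X]
    {Ω : Set X} (hΩ : IsOpen Ω) {x : X} (hx : x ∈ Ω) :
    Tendsto (kobayashiDist n Ω x) (𝓝 x) (𝓝 0) := by
  refine Metric.tendsto_nhds.2 fun ε hε => ?_
  have h1 : ∀ᶠ s : ℝ in 𝓝[>] 0, Real.artanh s < ε ∧ s < 1 ∧ 0 < s :=
    ((Real.tendsto_artanh_zero.mono_left nhdsWithin_le_nhds).eventually_lt_const hε).and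
      (((eventually_lt_nhds one_pos).filter_mono nhdsWithin_le_nhds).and self_mem_nhdsWithin)
  obtain ⟨s, hsε, hs1, hs0⟩ := h1.exists
  filter_upwards [eventually_isDiscChain_artanh (n := n) hΩ hx hs0 hs1] with y hy
  have h2 : kobayashiDist n Ω x y ≤ Real.artanh s := csInf_le (bddBelow_isDiscChain Ω x y) hy
  have h3 : 0 ≤ kobayashiDist n Ω x y := Real.sInf_nonneg fun _ h => h.nonneg
  rw [Real.dist_0_eq_abs, abs_of_nonneg h3]
  exact h2.trans_lt hsε

end Kobayashi

theorem mainTheorem11 {n : ℕ} {X : Type*} [TopologicalSpace X] [T2Space X]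
    [SecondCountableTopology X] [ChartedSpace (EuclideanSpace ℂ (Fin n)) X]
    [IsManifold 𝓘(ℂ, EuclideanSpace ℂ (Fin n)) ω X]
    (Ω : Set X) (hΩ : IsKobayashiHyperbolicDomain n Ω) (hΩX : Ω ≠ univ)
    (hcomplete : CompleteSpace (KobayashiSpace hΩ))
    (K : CompactExhaustion (closure Ω))
    (hF : ∃ F : metricCompactification (KobayashiSpace hΩ) → EndCompactification K,
      Continuous F ∧ Function.Surjective F ∧
      ∀ x : KobayashiSpace hΩ,
        F (toMetricCompactification x) = EndCompactification.point x.toClosure)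
    (γ : ℝ≥0 → KobayashiSpace hΩ) (hγ : Isometry γ) :
    ∃! x : EndCompactification K,
      x ∉ range (fun z : KobayashiSpace hΩ =>
        (EndCompactification.point z.toClosure : EndCompactification K)) ∧
      Tendsto (fun t => (EndCompactification.point (γ t).toClosure : EndCompactification K))
        atTop (𝓝 x) := by
  obtain ⟨F, hFc, -, hFi⟩ := hF
  obtain ⟨p, hp⟩ := exists_tendsto_toMetricCompactification hγ
  have hlim : Tendsto (fun t => (EndCompactification.point (γ t).toClosure :
      EndCompactification K)) atTop (𝓝 (F p)) :=
    ((hFc.tendsto p).comp hp).congr fun t => hFi (γ t)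
  -- Local compactness makes the Hausdorff space `X` regular; with second countability, `closure Ω`
  -- is then completely normal, as `instT2Space` requires.
  have : LocallyCompactSpace X := ChartedSpace.locallyCompactSpace (EuclideanSpace ℂ (Fin n)) X
  refine ⟨F p, ⟨?_, hlim⟩, fun x hx => tendsto_nhds_unique hx.2 hlim⟩
  rintro ⟨z, hz⟩
  have hz' : EndCompactification.point z.toClosure = F p := hz
  rw [← hz'] at hlim
  -- A limit in `Ω` would be a limit in `closure Ω`, hence in `X`, hence for `k_Ω`.
  have hY := EndCompactification.isOpenEmbedding_point.isInducing.tendsto_nhds_iff.2 hlim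
  have hX : Tendsto (fun t => ((γ t).toClosure : X)) atTop (𝓝 (z.toClosure : X)) :=
    (continuous_subtype_val.tendsto _).comp hY
  have hd := (tendsto_kobayashiDist_nhds (n := n) hΩ.isOpen z.2).comp hX
  refine not_tendsto_ray hγ z (tendsto_iff_dist_tendsto_zero.2 (hd.congr fun t => ?_))
  exact kobayashiDist_comm Ω _ _
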